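/- Let $0<q<1$. For $a,p\in\mathbb C$ with $|p|<1$ put $(a;p)_n=\prod_{j=0}^{n-1}(1-ap^j)$, $(a;p)_\infty=\prod_{j\ge 0}(1-ap^j)$ and $(a_1,\dots,a_r;p)_n=\prod_{i=1}^r(a_i;p)_n$. For $0<p<1$ and $x\in\mathbb C$ let $$\Gamma_p(x)=\frac{(p;p)_\infty}{(p^x;p)_\infty}(1-p)^{1-x},$$ where powers of positive reals are the principal ones; $1/\Gamma_p$ is entire, and it is taken to be $0$ at the poles of $\Gamma_p$. (i) Let $b,c,d\in\mathbb C$ be such that for every integer $m\ge 0$ none of $q^{2d+2+2m}$, $q^{2c+2d+2+2m}$, $q^{-2b+c+1/2+m}$, $q^{2-2b+2m}$ equals $1$ (that is, no denominator of the series below vanishes, and no $q$-gamma factor in the numerator of the right-hand side has a pole). Then the series below converges absolutely and $$\sum_{n\geq 0} \frac{q^{-2bn+cn+\frac{n^2}{2}}\,(1-q^{c+2d+3n+\frac12})\,(q^{\frac12-c},q^{c+\frac12},q^{c+2d+\frac12};q)_n\,(q^{2b+2d+1};q^2)_n}{(q^2,q^{2d+2},q^{2c+2d+2};q^2)_n\,(q^{-2b+c+\frac12};q)_n}$$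 $$=\frac{(1-q)(1+q)^{2d+1}\,\Gamma_{q^2}(1-b)\,\Gamma_{q^2}(d+1)\,\Gamma_q(-2b+c+\frac12)\,\Gamma_{q^2}(c+d+1)}{\Gamma_{q^2}(\frac12)\,\Gamma_q(1-2b)\,\Gamma_{q^2}(-b+c+\frac12)\,\Gamma_q(c+2d+\frac12)}.$$ (ii) In particular ($b=c=d=0$, with $q^2$ in place of $q$), with absolute convergence, $$\sum_{n\geq 0}\frac{q^{n^2}(1-q^{1+6n})\,(q;q^2)_n^2\,(q^2;q^4)_n}{(q^4;q^4)_n^3}=\frac{1-q^4}{\Gamma_{q^4}(\frac12)^2}.$$ (iii) The identity in (ii) is a $q$-analogue of $$\sum_{n\ge 0}\Big(\frac14\Big)^n\frac{(\frac12)_n^3}{(1)_n^3}(6n+1)=\frac4\pi,\qquad (x)_n=x(x+1)\cdots(x+n-1),$$ in the following sense: after division by $1-q$, for each $n\ge 0$ the $n$-th summand in (ii) tends to the $n$-th summand of this series, and the right-hand side in (ii) tends to $\frac4\pi$, as $q\to 1^-$. -/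

import Mathlib

open Filter Topology

/-- The finite `q`-shifted factorial `(a; q)_n = (1 - a) (1 - a q) ⋯ (1 - a q ^ (n - 1))`. -/
noncomputable def qPoch (a q : ℂ) (n : ℕ) : ℂ :=
  ∏ j ∈ Finset.range n, (1 - a * q ^ j)

/-- The infinite `q`-shifted factorial `(a; q)_∞ = ∏_{j ≥ 0} (1 - a q ^ j)`. It is used for
`|q| < 1` only, where the product converges (see `multipliable_qPochInf`). -/
noncomputable def qPochInf (a q : ℂ) : ℂ :=
  ∏' j : ℕ, (1 - a * q ^ j)

/-- The `q`-gamma function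
`Γ_q(x) = (q; q)_∞ / (q ^ x; q)_∞ * (1 - q) ^ (1 - x)`, for `0 < q < 1` and complex `x`; powers of
`q` and `1 - q` are the principal ones. Its poles are the zeros of `(q ^ x; q)_∞`, that is, the `x`
with `q ^ (x + m) = 1` for some natural number `m`. There the value given by division by zero is
`0`, so that `(Γ_q(x))⁻¹ = 0` at a pole, in agreement with the entire function `1 / Γ_q`. -/
noncomputable def qGamma (q : ℝ) (x : ℂ) : ℂ :=
  qPochInf q q / qPochInf ((q : ℂ) ^ x) q * (1 - q : ℂ) ^ (1 - x)

theorem multipliable_qPochInf (a : ℂ) {q : ℂ} (hq : ‖q‖ < 1) :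
    Multipliable fun j : ℕ => 1 - a * q ^ j := by
  have h : Summable fun j : ℕ => ‖-(a * q ^ j)‖ := by
    simp only [norm_neg, norm_mul, norm_pow]
    exact (summable_geometric_of_lt_one (norm_nonneg q) hq).mul_left _
  simpa [sub_eq_add_neg] using multipliable_one_add_of_summable h

/-! Part (i) is a quadratic summation with `B * B' = q`, proved by regarding the series as a
function of `z = q ^ (-(2b+2d+1))`. Multiplied by `(aqz; q)_∞`, it becomes a sum `S(z)` of entire
functions whose terms decay like `q ^ (k²/2)`. Telescoping (`sum_quadTerm_sub`) gives `S(z) = (1 -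
aqBz)(1 - aqB'z) S(q²z)`, so iteration and continuity at `0` give `S(z) = (aqBz, aqB'z; q²)_∞ S(0)`.
At `z = 1` only the term `k = 0` survives and `S(1) = (a; q)_∞`, which determines `S(0)`. The rest
of (i) rewrites infinite products as `q`-gamma functions.

Part (ii) is the same summation in base `q²` with `a = B = B' = q` and `z = q⁻²`.

For (iii), the summands become rational functions continuous at `1` once all powers of `1 - q` are
cancelled. On the right, `Γ_{p²}(1/2)²` with `p = q²` is `1 + p` times a `q`-analogue of Wallis'
product, and dominated convergence gives its limit `π/2`. -/

/-! ### Finite and infinite `q`-shifted factorials: limits and bounds. -/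

theorem qPoch_zero (a q : ℂ) : qPoch a q 0 = 1 := by simp [qPoch]

theorem qPoch_succ (a q : ℂ) (n : ℕ) : qPoch a q (n + 1) = qPoch a q n * (1 - a * q ^ n) :=
  Finset.prod_range_succ _ _

theorem qPoch_ne_zero {a q : ℂ} (h : ∀ m : ℕ, a * q ^ m ≠ 1) (n : ℕ) : qPoch a q n ≠ 0 :=
  Finset.prod_ne_zero_iff.2 fun m _ => sub_ne_zero.2 (h m).symm

theorem tendsto_qPoch (a : ℂ) {q : ℂ} (hq : ‖q‖ < 1) :
    Tendsto (qPoch a q) atTop (𝓝 (qPochInf a q)) :=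
  (multipliable_qPochInf a hq).hasProd.tendsto_prod_nat

theorem qPochInf_eq_qPoch_mul (a : ℂ) {q : ℂ} (hq : ‖q‖ < 1) (n : ℕ) :
    qPochInf a q = qPoch a q n * qPochInf (a * q ^ n) q := by
  have h : Tendsto (fun m => qPoch a q (m + n)) atTop (𝓝 (qPochInf a q)) :=
    (tendsto_add_atTop_iff_nat n).2 (tendsto_qPoch a hq)
  refine tendsto_nhds_unique h ?_
  convert (tendsto_qPoch (a * q ^ n) hq).const_mul (qPoch a q n) using 2 with m
  rw [add_comm, qPoch, Finset.prod_range_add]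
  simp only [qPoch, pow_add, mul_assoc]

theorem qPochInf_eq_one_sub_mul (a : ℂ) {q : ℂ} (hq : ‖q‖ < 1) :
    qPochInf a q = (1 - a) * qPochInf (a * q) q := by
  simpa [qPoch] using qPochInf_eq_qPoch_mul a hq 1

/-- The bound does not depend on `n`, so it passes to the infinite product, and it vanishes with
`a`, which yields continuity of `(a; q)_∞` at `a = 0`. -/
theorem norm_qPoch_sub_one_le (a : ℂ) {q : ℂ} (hq : ‖q‖ < 1) (n : ℕ) :
    ‖qPoch a q n - 1‖ ≤ Real.exp (‖a‖ * (1 - ‖q‖)⁻¹) - 1 := by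
  have h := Finset.norm_prod_one_add_sub_one_le (Finset.range n) fun j => -(a * q ^ j)
  simp only [← sub_eq_add_neg] at h
  refine h.trans (sub_le_sub_right (Real.exp_le_exp.2 ?_) 1)
  simp only [norm_neg, norm_mul, norm_pow, ← Finset.mul_sum]
  refine mul_le_mul_of_nonneg_left ?_ (norm_nonneg a)
  rw [← tsum_geometric_of_lt_one (norm_nonneg q) hq]
  exact (summable_geometric_of_lt_one (norm_nonneg q) hq).sum_le_tsum _ fun _ _ => by positivity

theorem norm_qPochInf_sub_one_le (a : ℂ) {q : ℂ} (hq : ‖q‖ < 1) :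
    ‖qPochInf a q - 1‖ ≤ Real.exp (‖a‖ * (1 - ‖q‖)⁻¹) - 1 :=
  le_of_tendsto ((tendsto_qPoch a hq).sub_const 1).norm
    (Eventually.of_forall (norm_qPoch_sub_one_le a hq))

theorem norm_qPoch_le (a : ℂ) {q : ℂ} (hq : ‖q‖ < 1) (n : ℕ) :
    ‖qPoch a q n‖ ≤ Real.exp (‖a‖ * (1 - ‖q‖)⁻¹) := by
  have h1 := norm_qPoch_sub_one_le a hq n
  have h2 := norm_le_norm_sub_add (qPoch a q n) 1
  rw [norm_one] at h2
  linarith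

theorem norm_qPochInf_le (a : ℂ) {q : ℂ} (hq : ‖q‖ < 1) :
    ‖qPochInf a q‖ ≤ Real.exp (‖a‖ * (1 - ‖q‖)⁻¹) :=
  le_of_tendsto (tendsto_qPoch a hq).norm (Eventually.of_forall (norm_qPoch_le a hq))

theorem tendsto_qPochInf_zero {q : ℂ} (hq : ‖q‖ < 1) :
    Tendsto (fun a => qPochInf a q) (𝓝 0) (𝓝 1) := by
  rw [tendsto_iff_norm_sub_tendsto_zero]
  refine squeeze_zero (fun _ => norm_nonneg _) (fun a => norm_qPochInf_sub_one_le a hq) ?_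
  have h : Continuous fun a : ℂ => Real.exp (‖a‖ * (1 - ‖q‖)⁻¹) - 1 := by fun_prop
  simpa using h.tendsto 0

theorem qPochInf_ne_zero {a q : ℂ} (hq : ‖q‖ < 1) (h : ∀ m : ℕ, a * q ^ m ≠ 1) :
    qPochInf a q ≠ 0 := by
  have hs : Summable fun j : ℕ => ‖-(a * q ^ j)‖ := by
    simp only [norm_neg, norm_mul, norm_pow]
    exact (summable_geometric_of_lt_one (norm_nonneg q) hq).mul_left _
  have := tprod_one_add_ne_zero_of_summable (f := fun j : ℕ => -(a * q ^ j))
    (fun j => by simpa [← sub_eq_add_neg] using sub_ne_zero.2 (h j).symm) hs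
  simpa [qPochInf, sub_eq_add_neg] using this

/-- The inverses converge because the limit `(a; q)_∞` is nonzero, and a convergent sequence is
bounded. -/
theorem exists_norm_inv_qPoch_le {a q : ℂ} (hq : ‖q‖ < 1) (h : ∀ m : ℕ, a * q ^ m ≠ 1) :
    ∃ C : ℝ, ∀ n, ‖(qPoch a q n)⁻¹‖ ≤ C := by
  obtain ⟨C, hC⟩ := (Metric.isBounded_range_of_tendsto _
    ((tendsto_qPoch a hq).inv₀ (qPochInf_ne_zero hq h))).exists_norm_le
  exact ⟨C, fun n => hC _ ⟨n, rfl⟩⟩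

theorem mul_pow_ne_one {a q : ℂ} (hq : ‖q‖ < 1) (ha : ‖a‖ < 1) (m : ℕ) : a * q ^ m ≠ 1 := by
  intro h
  have h1 : ‖a‖ * ‖q‖ ^ m = 1 := by rw [← norm_pow, ← norm_mul, h, norm_one]
  have h2 : ‖a‖ * ‖q‖ ^ m ≤ ‖a‖ :=
    mul_le_of_le_one_right (norm_nonneg a) (pow_le_one₀ (norm_nonneg q) hq.le)
  linarith

theorem norm_sq_lt_one {q : ℂ} (hq : ‖q‖ < 1) : ‖q ^ 2‖ < 1 := by
  rw [norm_pow]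
  exact pow_lt_one₀ (norm_nonneg q) hq two_ne_zero

/-- Splitting `(a; q)_∞` into the factors of even and of odd index. -/
theorem qPochInf_eq_mul_sq (a : ℂ) {q : ℂ} (hq : ‖q‖ < 1) :
    qPochInf a q = qPochInf a (q ^ 2) * qPochInf (a * q) (q ^ 2) := by
  have h : ∀ n, qPoch a q (2 * n) = qPoch a (q ^ 2) n * qPoch (a * q) (q ^ 2) n := by
    intro n
    induction n with
    | zero => simp [qPoch]
    | succ n ih =>
      rw [show 2 * (n + 1) = 2 * n + 1 + 1 by ring, qPoch_succ, qPoch_succ, ih, qPoch_succ,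
        qPoch_succ]
      ring
  have h2 : Tendsto (fun n : ℕ => 2 * n) atTop atTop := tendsto_id.const_mul_atTop' two_pos
  refine tendsto_nhds_unique ((tendsto_qPoch a hq).comp h2) ?_
  refine ((tendsto_qPoch a (norm_sq_lt_one hq)).mul
    (tendsto_qPoch (a * q) (norm_sq_lt_one hq))).congr fun n => (h n).symm

/-! ### The quadratic series: its terms and their bounds. -/

/-- The ratio of consecutive terms is `M * r ^ (k + 1)`, which tends to `0`. This is the majorant
for every series in `z`, with `M` absorbing the growth of `quadPoly`. -/
theorem summable_pow_mul_pow_choose (M : ℝ) {r : ℝ} (hr0 : 0 ≤ r) (hr : r < 1) :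
    Summable fun k : ℕ => M ^ k * r ^ (k + 1).choose 2 := by
  have ht : Tendsto (fun k : ℕ => |M| * r ^ (k + 1)) atTop (𝓝 0) := by
    simpa using ((tendsto_add_atTop_iff_nat 1).2
      (tendsto_pow_atTop_nhds_zero_of_lt_one hr0 hr)).const_mul |M|
  refine summable_of_ratio_norm_eventually_le (r := 1 / 2) (by norm_num) ?_
  filter_upwards [ht.eventually_le_const (show (0 : ℝ) < 1 / 2 by norm_num)] with k hk
  have hc : (k + 1 + 1).choose 2 = (k + 1).choose 2 + (k + 1) := by
    rw [Nat.choose_succ_succ' (k + 1) 1, Nat.choose_one_right, add_comm]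
  rw [hc, show M ^ (k + 1) * r ^ ((k + 1).choose 2 + (k + 1))
    = (M * r ^ (k + 1)) * (M ^ k * r ^ (k + 1).choose 2) by ring, norm_mul]
  refine mul_le_mul_of_nonneg_right ?_ (norm_nonneg _)
  rwa [norm_mul, Real.norm_eq_abs, Real.norm_of_nonneg (by positivity)]

/-- The factor of the summand of the quadratic summation that does not depend on `z`. -/
noncomputable def quadCoeff (q a B B' : ℂ) (k : ℕ) : ℂ :=
  a ^ k * q ^ (k + 1).choose 2 * (qPoch a q k * qPoch B q k * qPoch B' q k)
    * ((qPoch (q ^ 2) (q ^ 2) k)⁻¹ * (qPoch (a * q * B) (q ^ 2) k)⁻¹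
      * (qPoch (a * q * B') (q ^ 2) k)⁻¹)

/-- The polynomial `∏_{j < k} (z - q ^ (2 j))`, which is `z ^ k (1 / z; q²)_k` for `z ≠ 0`. -/
noncomputable def quadPoly (q z : ℂ) (k : ℕ) : ℂ :=
  ∏ j ∈ Finset.range k, (z - (q ^ 2) ^ j)

/-- The summand of the quadratic summation, multiplied by `(a q z; q)_∞`. It is entire in `z`. -/
noncomputable def quadTerm (q a B B' z : ℂ) (k : ℕ) : ℂ :=
  quadCoeff q a B B' k * (1 - a * q ^ (3 * k)) * quadPoly q z k
    * qPochInf (a * z * q ^ (k + 1)) q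

theorem quadPoly_succ (q z : ℂ) (k : ℕ) :
    quadPoly q z (k + 1) = quadPoly q z k * (z - (q ^ 2) ^ k) :=
  Finset.prod_range_succ _ _

/-- Replacing `z` by `q² z` shifts the roots by one index. In the telescoping, both polynomials of
degree `k + 1` thus become multiples of `quadPoly q z k`. -/
theorem quadPoly_succ_sq_mul (q z : ℂ) (k : ℕ) :
    quadPoly q (q ^ 2 * z) (k + 1) = (q ^ 2) ^ k * (q ^ 2 * z - 1) * quadPoly q z k := by
  have h : ∀ j, q ^ 2 * z - (q ^ 2) ^ (j + 1) = q ^ 2 * (z - (q ^ 2) ^ j) := fun j => by ring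
  simp only [quadPoly, Finset.prod_range_succ', h, Finset.prod_mul_distrib, Finset.prod_const,
    Finset.card_range, pow_zero]
  ring

theorem quadPoly_eq_pow_mul_qPoch {q z D : ℂ} (h : z * D = 1) (k : ℕ) :
    quadPoly q z k = z ^ k * qPoch D (q ^ 2) k := by
  have e : ∀ j, z - (q ^ 2) ^ j = z * (1 - D * (q ^ 2) ^ j) := fun j => by
    linear_combination (q ^ 2) ^ j * h
  simp only [quadPoly, qPoch, e, Finset.prod_mul_distrib, Finset.prod_const, Finset.card_range]

theorem norm_quadPoly_le {q z : ℂ} (hq : ‖q‖ < 1) (k : ℕ) :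
    ‖quadPoly q z k‖ ≤ (‖z‖ + 1) ^ k := by
  rw [quadPoly, norm_prod]
  calc ∏ j ∈ Finset.range k, ‖z - (q ^ 2) ^ j‖ ≤ ∏ _j ∈ Finset.range k, (‖z‖ + 1) := by
        refine Finset.prod_le_prod (fun _ _ => norm_nonneg _) fun j _ => ?_
        refine (norm_sub_le _ _).trans (add_le_add_right ?_ _)
        rw [norm_pow]
        exact pow_le_one₀ (norm_nonneg _) (norm_sq_lt_one hq).le
    _ = (‖z‖ + 1) ^ k := by simp

theorem continuous_quadPoly (q : ℂ) (k : ℕ) : Continuous fun z => quadPoly q z k := by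
  unfold quadPoly
  fun_prop

theorem choose_two_succ (k : ℕ) : (k + 1 + 1).choose 2 = (k + 1).choose 2 + (k + 1) := by
  rw [Nat.choose_succ_succ' (k + 1) 1, Nat.choose_one_right, add_comm]

/-- The ratio of consecutive coefficients, cleared of denominators so that it can enter a
`linear_combination`. -/
theorem quadCoeff_succ_mul {q a B B' : ℂ} (hq : ‖q‖ < 1)
    (h₁ : ∀ m : ℕ, a * q * B * (q ^ 2) ^ m ≠ 1) (h₂ : ∀ m : ℕ, a * q * B' * (q ^ 2) ^ m ≠ 1)
    (k : ℕ) :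
    quadCoeff q a B B' (k + 1) * ((1 - q ^ 2 * (q ^ 2) ^ k) * (1 - a * q * B * (q ^ 2) ^ k)
        * (1 - a * q * B' * (q ^ 2) ^ k))
      = quadCoeff q a B B' k * ((1 - a * q ^ k) * (1 - B * q ^ k) * (1 - B' * q ^ k)
        * (a * q ^ (k + 1))) := by
  have e₀ := sub_ne_zero.2 (mul_pow_ne_one (norm_sq_lt_one hq) (norm_sq_lt_one hq) k).symm
  have e₁ := sub_ne_zero.2 (h₁ k).symm
  have e₂ := sub_ne_zero.2 (h₂ k).symm
  simp only [quadCoeff, qPoch_succ, choose_two_succ, pow_add _ _ (k + 1), mul_inv]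
  generalize (k + 1).choose 2 = N
  generalize (qPoch (q ^ 2) (q ^ 2) k)⁻¹ = X₀
  generalize (qPoch (a * q * B) (q ^ 2) k)⁻¹ = X₁
  generalize (qPoch (a * q * B') (q ^ 2) k)⁻¹ = X₂
  generalize qPoch a q k = A₀
  generalize qPoch B q k = A₁
  generalize qPoch B' q k = A₂
  generalize q ^ N = Q
  generalize q ^ (k + 1) = Q'
  generalize q ^ k = x
  generalize 1 - q ^ 2 * (q ^ 2) ^ k = y₀ at *
  generalize 1 - a * q * B * (q ^ 2) ^ k = y₁ at *
  generalize 1 - a * q * B' * (q ^ 2) ^ k = y₂ at *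
  clear h₁ h₂
  field_simp
  ring

theorem exists_norm_quadCoeff_le {q a B B' : ℂ} (hq : ‖q‖ < 1)
    (h₁ : ∀ m : ℕ, a * q * B * (q ^ 2) ^ m ≠ 1) (h₂ : ∀ m : ℕ, a * q * B' * (q ^ 2) ^ m ≠ 1) :
    ∃ C : ℝ, 0 ≤ C ∧ ∀ k, ‖quadCoeff q a B B' k‖ ≤ C * (‖a‖ ^ k * ‖q‖ ^ (k + 1).choose 2) := by
  obtain ⟨C₀, h₀⟩ := exists_norm_inv_qPoch_le (norm_sq_lt_one hq)
    (mul_pow_ne_one (norm_sq_lt_one hq) (norm_sq_lt_one hq))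
  obtain ⟨C₁, h₁⟩ := exists_norm_inv_qPoch_le (norm_sq_lt_one hq) h₁
  obtain ⟨C₂, h₂⟩ := exists_norm_inv_qPoch_le (norm_sq_lt_one hq) h₂
  have p₀ := (norm_nonneg _).trans (h₀ 0)
  have p₁ := (norm_nonneg _).trans (h₁ 0)
  have p₂ := (norm_nonneg _).trans (h₂ 0)
  refine ⟨Real.exp (‖a‖ * (1 - ‖q‖)⁻¹) * Real.exp (‖B‖ * (1 - ‖q‖)⁻¹)
    * Real.exp (‖B'‖ * (1 - ‖q‖)⁻¹) * (C₀ * C₁ * C₂), by positivity, fun k => ?_⟩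
  rw [quadCoeff, mul_assoc (a ^ k * _), mul_comm (a ^ k * _)]
  simp only [norm_mul, norm_pow]
  gcongr
  exacts [norm_qPoch_le a hq k, norm_qPoch_le B hq k, norm_qPoch_le B' hq k, h₀ k, h₁ k, h₂ k]

theorem norm_qPochInf_mul_pow_le {q x : ℂ} (hq : ‖q‖ < 1) (k : ℕ) :
    ‖qPochInf (x * q ^ k) q‖ ≤ Real.exp (‖x‖ * (1 - ‖q‖)⁻¹) := by
  refine (norm_qPochInf_le _ hq).trans (Real.exp_le_exp.2 ?_)
  have : 0 ≤ (1 - ‖q‖)⁻¹ := inv_nonneg.2 (sub_nonneg.2 hq.le)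
  refine mul_le_mul_of_nonneg_right ?_ this
  rw [norm_mul, norm_pow]
  exact mul_le_of_le_one_right (norm_nonneg x) (pow_le_one₀ (norm_nonneg q) hq.le)

/-- A bound for expressions of the shape of `quadTerm`, uniform for `z` in a disc. -/
theorem exists_norm_quad_le {q a B B' : ℂ} (hq : ‖q‖ < 1)
    (h₁ : ∀ m : ℕ, a * q * B * (q ^ 2) ^ m ≠ 1) (h₂ : ∀ m : ℕ, a * q * B' * (q ^ 2) ^ m ≠ 1)
    (R : ℝ) :
    ∃ C M : ℝ, ∀ z : ℂ, ‖z‖ ≤ R → ∀ k l : ℕ,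
      ‖quadCoeff q a B B' k * quadPoly q z k * qPochInf (a * z * q ^ l) q‖
        ≤ C * (M ^ k * ‖q‖ ^ (k + 1).choose 2) := by
  obtain ⟨C, hC0, hC⟩ := exists_norm_quadCoeff_le hq h₁ h₂
  refine ⟨C * Real.exp (‖a‖ * R * (1 - ‖q‖)⁻¹), ‖a‖ * (R + 1), fun z hz k l => ?_⟩
  have hi : 0 ≤ (1 - ‖q‖)⁻¹ := inv_nonneg.2 (sub_nonneg.2 hq.le)
  have hR : 0 ≤ R := (norm_nonneg z).trans hz
  have hE : ‖qPochInf (a * z * q ^ l) q‖ ≤ Real.exp (‖a‖ * R * (1 - ‖q‖)⁻¹) := by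
    refine (norm_qPochInf_mul_pow_le hq l).trans (Real.exp_le_exp.2 ?_)
    rw [norm_mul]
    gcongr
  have hP : ‖quadPoly q z k‖ ≤ (R + 1) ^ k :=
    (norm_quadPoly_le hq k).trans (by gcongr)
  calc ‖quadCoeff q a B B' k * quadPoly q z k * qPochInf (a * z * q ^ l) q‖
      ≤ C * (‖a‖ ^ k * ‖q‖ ^ (k + 1).choose 2) * (R + 1) ^ k
        * Real.exp (‖a‖ * R * (1 - ‖q‖)⁻¹) := by
        rw [norm_mul, norm_mul]
        gcongr
        exact hC k
    _ = _ := by rw [mul_pow]; ring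

theorem norm_one_sub_mul_pow_le {q : ℂ} (hq : ‖q‖ < 1) (x : ℂ) (n : ℕ) :
    ‖1 - x * q ^ n‖ ≤ 1 + ‖x‖ := by
  refine (norm_sub_le _ _).trans ?_
  rw [norm_one, norm_mul, norm_pow]
  exact add_le_add_right
    (mul_le_of_le_one_right (norm_nonneg x) (pow_le_one₀ (norm_nonneg q) hq.le)) 1

theorem exists_norm_quadTerm_le {q a B B' : ℂ} (hq : ‖q‖ < 1)
    (h₁ : ∀ m : ℕ, a * q * B * (q ^ 2) ^ m ≠ 1) (h₂ : ∀ m : ℕ, a * q * B' * (q ^ 2) ^ m ≠ 1)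
    (R : ℝ) :
    ∃ C M : ℝ, ∀ z : ℂ, ‖z‖ ≤ R → ∀ k : ℕ,
      ‖quadTerm q a B B' z k‖ ≤ C * (M ^ k * ‖q‖ ^ (k + 1).choose 2) := by
  obtain ⟨C, M, h⟩ := exists_norm_quad_le hq h₁ h₂ R
  refine ⟨(1 + ‖a‖) * C, M, fun z hz k => ?_⟩
  have e : quadTerm q a B B' z k = (1 - a * q ^ (3 * k))
      * (quadCoeff q a B B' k * quadPoly q z k * qPochInf (a * z * q ^ (k + 1)) q) := by
    rw [quadTerm]
    ring
  rw [e, norm_mul, mul_assoc (1 + ‖a‖)]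
  exact mul_le_mul (norm_one_sub_mul_pow_le hq a _) (h z hz k (k + 1)) (norm_nonneg _)
    (by positivity)

theorem summable_quadTerm {q a B B' : ℂ} (hq : ‖q‖ < 1)
    (h₁ : ∀ m : ℕ, a * q * B * (q ^ 2) ^ m ≠ 1) (h₂ : ∀ m : ℕ, a * q * B' * (q ^ 2) ^ m ≠ 1)
    (z : ℂ) : Summable (quadTerm q a B B' z) := by
  obtain ⟨C, M, h⟩ := exists_norm_quadTerm_le hq h₁ h₂ ‖z‖
  exact .of_norm_bounded ((summable_pow_mul_pow_choose M (norm_nonneg q) hq).mul_left C)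
    (h z le_rfl)

/-! ### The contiguous relation in `z`, its iteration, and the quadratic summation. -/

/-- The telescoping that underlies the contiguous relation in `z`. -/
theorem sum_quadTerm_sub {q a B B' : ℂ} (hq : ‖q‖ < 1) (hB : B * B' = q)
    (h₁ : ∀ m : ℕ, a * q * B * (q ^ 2) ^ m ≠ 1) (h₂ : ∀ m : ℕ, a * q * B' * (q ^ 2) ^ m ≠ 1)
    (z : ℂ) (n : ℕ) :
    ∑ k ∈ Finset.range (n + 1), (quadTerm q a B B' z k
        - (1 - a * q * B * z) * (1 - a * q * B' * z) * quadTerm q a B B' (q ^ 2 * z) k)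
      = -z * ((1 - a * q ^ n) * (1 - B * q ^ n) * (1 - B' * q ^ n) * (a * q ^ (n + 1)))
        * (quadCoeff q a B B' n * quadPoly q z n * qPochInf (a * z * q ^ (n + 3)) q) := by
  have hE : ∀ l, qPochInf (a * z * q ^ l) q
      = (1 - a * z * q ^ l) * qPochInf (a * z * q ^ (l + 1)) q := fun l => by
    rw [qPochInf_eq_one_sub_mul _ hq, mul_assoc (a * z), ← pow_succ]
  have hE2 : ∀ l, qPochInf (a * (q ^ 2 * z) * q ^ l) q = qPochInf (a * z * q ^ (l + 2)) q :=
    fun l => by congr 1; ring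
  induction n with
  | zero =>
    simp only [zero_add, Finset.sum_range_one, quadTerm, hE2]
    rw [hE 1, hE 2]
    simp only [quadPoly, quadCoeff, qPoch_zero, Finset.range_zero, Finset.prod_empty]
    norm_num
    generalize qPochInf (a * z * q ^ 3) q = E
    subst hB
    ring
  | succ n ih =>
    rw [Finset.sum_range_succ, ih]
    have hc := quadCoeff_succ_mul hq h₁ h₂ n
    simp only [quadTerm, hE2, quadPoly_succ_sq_mul]
    simp only [quadPoly_succ, show n + 1 + 1 = n + 2 by ring, show n + 2 + 2 = n + 4 by ring]
    rw [hE (n + 2), hE (n + 2 + 1)]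
    simp only [show n + 2 + 1 = n + 3 by ring, show n + 3 + 1 = n + 4 by ring]
    generalize qPochInf (a * z * q ^ (n + 4)) q = E at *
    generalize quadPoly q z n = P at *
    generalize quadCoeff q a B B' (n + 1) = c' at *
    generalize quadCoeff q a B B' n = c at *
    have e₂ : (q ^ 2) ^ n = (q ^ n) ^ 2 := pow_right_comm q 2 n
    have e₃ : q ^ (3 * (n + 1)) = (q ^ n) ^ 3 * q ^ 3 := by ring
    simp only [e₂, e₃, pow_add q n] at hc ⊢
    generalize q ^ n = x at *
    subst hB
    -- The remainder at `n` contains the right side of `hc`. This multiplier, whose last factor is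
    -- `1 - a z q ^ (n + 3)`, trades it for the coefficient at `n + 1`; a polynomial identity
    -- remains.
    linear_combination (z * P * E * (1 - a * z * ((B * B') ^ 3 * x))) * hc

theorem tsum_quadTerm_eq {q a B B' : ℂ} (hq : ‖q‖ < 1) (hB : B * B' = q)
    (h₁ : ∀ m : ℕ, a * q * B * (q ^ 2) ^ m ≠ 1) (h₂ : ∀ m : ℕ, a * q * B' * (q ^ 2) ^ m ≠ 1)
    (z : ℂ) :
    ∑' k, quadTerm q a B B' z k
      = (1 - a * q * B * z) * (1 - a * q * B' * z) * ∑' k, quadTerm q a B B' (q ^ 2 * z) k := by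
  rw [← sub_eq_zero, ← tsum_mul_left,
    ← (summable_quadTerm hq h₁ h₂ z).tsum_sub ((summable_quadTerm hq h₁ h₂ _).mul_left _)]
  have hs := ((summable_quadTerm hq h₁ h₂ z).sub
    ((summable_quadTerm hq h₁ h₂ (q ^ 2 * z)).mul_left
      ((1 - a * q * B * z) * (1 - a * q * B' * z)))).hasSum.tendsto_sum_nat
  refine tendsto_nhds_unique ((tendsto_add_atTop_iff_nat 1).2 hs) ?_
  simp only [sum_quadTerm_sub hq hB h₁ h₂]
  obtain ⟨C, M, h⟩ := exists_norm_quad_le hq h₁ h₂ ‖z‖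
  have h0 := ((summable_pow_mul_pow_choose M (norm_nonneg q) hq).mul_left
    (‖z‖ * ((1 + ‖a‖) * (1 + ‖B‖) * (1 + ‖B'‖) * ‖a‖) * C)).tendsto_atTop_zero
  -- The telescoped remainder tends to `0`: its first factors are bounded and the last is a term of
  -- the summable majorant.
  refine squeeze_zero_norm (fun n => ?_) h0
  rw [norm_mul, mul_assoc (_ * _) C]
  refine mul_le_mul ?_ (h z le_rfl n (n + 3)) (norm_nonneg _) (by positivity)
  simp only [norm_mul, norm_neg]
  gcongr
  · exact norm_one_sub_mul_pow_le hq _ _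
  · exact norm_one_sub_mul_pow_le hq _ _
  · exact norm_one_sub_mul_pow_le hq _ _
  · rw [norm_pow]
    exact mul_le_of_le_one_right (norm_nonneg a) (pow_le_one₀ (norm_nonneg q) hq.le)

theorem tsum_quadTerm_eq_qPoch_mul {q a B B' : ℂ} (hq : ‖q‖ < 1) (hB : B * B' = q)
    (h₁ : ∀ m : ℕ, a * q * B * (q ^ 2) ^ m ≠ 1) (h₂ : ∀ m : ℕ, a * q * B' * (q ^ 2) ^ m ≠ 1)
    (z : ℂ) (n : ℕ) :
    ∑' k, quadTerm q a B B' z k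
      = qPoch (a * q * B * z) (q ^ 2) n * qPoch (a * q * B' * z) (q ^ 2) n
        * ∑' k, quadTerm q a B B' ((q ^ 2) ^ n * z) k := by
  induction n with
  | zero => simp [qPoch]
  | succ n ih =>
    rw [ih, tsum_quadTerm_eq hq hB h₁ h₂ ((q ^ 2) ^ n * z), qPoch_succ, qPoch_succ,
      pow_succ' (q ^ 2) n, mul_assoc (q ^ 2)]
    ring

theorem tendsto_tsum_quadTerm {q a B B' : ℂ} (hq : ‖q‖ < 1)
    (h₁ : ∀ m : ℕ, a * q * B * (q ^ 2) ^ m ≠ 1) (h₂ : ∀ m : ℕ, a * q * B' * (q ^ 2) ^ m ≠ 1) :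
    Tendsto (fun z => ∑' k, quadTerm q a B B' z k) (𝓝 0)
      (𝓝 (∑' k, quadTerm q a B B' 0 k)) := by
  obtain ⟨C, M, h⟩ := exists_norm_quadTerm_le hq h₁ h₂ 1
  refine tendsto_tsum_of_dominated_convergence
    ((summable_pow_mul_pow_choose M (norm_nonneg q) hq).mul_left C) (fun k => ?_) ?_
  · unfold quadTerm
    refine (((continuous_quadPoly q k).tendsto 0).const_mul _).mul ?_
    have hc : Tendsto (fun z : ℂ => a * z * q ^ (k + 1)) (𝓝 0) (𝓝 0) := by
      have : Continuous fun z : ℂ => a * z * q ^ (k + 1) := by fun_prop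
      simpa using this.tendsto 0
    have h0 : qPochInf (a * 0 * q ^ (k + 1)) q = 1 := by simp [qPochInf]
    rw [h0]
    exact (tendsto_qPochInf_zero hq).comp hc
  · filter_upwards [Metric.closedBall_mem_nhds (0 : ℂ) one_pos] with z hz k
    exact h z (mem_closedBall_zero_iff.1 hz) k

theorem tsum_quadTerm_eq_qPochInf_mul {q a B B' : ℂ} (hq : ‖q‖ < 1) (hB : B * B' = q)
    (h₁ : ∀ m : ℕ, a * q * B * (q ^ 2) ^ m ≠ 1) (h₂ : ∀ m : ℕ, a * q * B' * (q ^ 2) ^ m ≠ 1)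
    (z : ℂ) :
    ∑' k, quadTerm q a B B' z k
      = qPochInf (a * q * B * z) (q ^ 2) * qPochInf (a * q * B' * z) (q ^ 2)
        * ∑' k, quadTerm q a B B' 0 k := by
  have hz : Tendsto (fun n : ℕ => (q ^ 2) ^ n * z) atTop (𝓝 0) := by
    simpa using (tendsto_pow_atTop_nhds_zero_of_norm_lt_one (norm_sq_lt_one hq)).mul_const z
  refine tendsto_nhds_unique (f := fun _ : ℕ => _) (l := atTop) tendsto_const_nhds (Tendsto.congr
    (fun n => (tsum_quadTerm_eq_qPoch_mul hq hB h₁ h₂ z n).symm) ?_)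
  exact ((tendsto_qPoch _ (norm_sq_lt_one hq)).mul (tendsto_qPoch _ (norm_sq_lt_one hq))).mul
    ((tendsto_tsum_quadTerm hq h₁ h₂).comp hz)

/-- Each `quadPoly q z k` with `k ≥ 1` has the factor `z - 1`. This evaluation fixes the unknown
constant `S(0)`. -/
theorem tsum_quadTerm_one {q a B B' : ℂ} (hq : ‖q‖ < 1) :
    ∑' k, quadTerm q a B B' 1 k = qPochInf a q := by
  rw [tsum_eq_single 0, qPochInf_eq_one_sub_mul a hq]
  · simp [quadTerm, quadCoeff, quadPoly, qPoch]
  · intro k hk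
    have : quadPoly q 1 k = 0 :=
      Finset.prod_eq_zero (Finset.mem_range.2 (Nat.pos_of_ne_zero hk)) (by simp)
    simp [quadTerm, this]

/-- The limit case of Rahman's quadratic summation formula in which one numerator parameter tends
to infinity; `B * B' = q`. -/
theorem hasSum_quadTerm {q a B B' : ℂ} (hq : ‖q‖ < 1) (hB : B * B' = q)
    (h₁ : ∀ m : ℕ, a * q * B * (q ^ 2) ^ m ≠ 1) (h₂ : ∀ m : ℕ, a * q * B' * (q ^ 2) ^ m ≠ 1)
    (z : ℂ) :
    HasSum (quadTerm q a B B' z)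
      (qPochInf a q * (qPochInf (a * q * B * z) (q ^ 2) * qPochInf (a * q * B' * z) (q ^ 2))
        / (qPochInf (a * q * B) (q ^ 2) * qPochInf (a * q * B') (q ^ 2))) := by
  have h := (summable_quadTerm hq h₁ h₂ z).hasSum
  convert h using 1
  have e := tsum_quadTerm_eq_qPochInf_mul hq hB h₁ h₂ 1
  rw [tsum_quadTerm_one hq, mul_one, mul_one] at e
  rw [tsum_quadTerm_eq_qPochInf_mul hq hB h₁ h₂ z, e]
  have n₁ := qPochInf_ne_zero (norm_sq_lt_one hq) h₁
  have n₂ := qPochInf_ne_zero (norm_sq_lt_one hq) h₂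
  field_simp

/-- Division by `(aqz; q)_∞ = (aqz; q)_k (azq^(k+1); q)_∞` restores the hypergeometric form. -/
theorem hasSum_quadratic {q a B B' z D : ℂ} (hq : ‖q‖ < 1) (hB : B * B' = q) (hD : z * D = 1)
    (h₁ : ∀ m : ℕ, a * q * B * (q ^ 2) ^ m ≠ 1) (h₂ : ∀ m : ℕ, a * q * B' * (q ^ 2) ^ m ≠ 1)
    (h₃ : ∀ m : ℕ, a * q * z * q ^ m ≠ 1) :
    HasSum (fun k : ℕ => (a * z) ^ k * q ^ (k + 1).choose 2 * (1 - a * q ^ (3 * k))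
        * (qPoch a q k * qPoch B q k * qPoch B' q k) * qPoch D (q ^ 2) k
        / (qPoch (q ^ 2) (q ^ 2) k * qPoch (a * q * B) (q ^ 2) k * qPoch (a * q * B') (q ^ 2) k
          * qPoch (a * q * z) q k))
      (qPochInf a q * (qPochInf (a * q * B * z) (q ^ 2) * qPochInf (a * q * B' * z) (q ^ 2))
        / (qPochInf (a * q * B) (q ^ 2) * qPochInf (a * q * B') (q ^ 2)
          * qPochInf (a * q * z) q)) := by
  have h := (hasSum_quadTerm hq hB h₁ h₂ z).div_const (qPochInf (a * q * z) q)
  rw [div_div] at h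
  refine h.congr_fun fun k => ?_
  have n := qPochInf_ne_zero hq h₃
  have e : qPochInf (a * q * z) q = qPoch (a * q * z) q k * qPochInf (a * z * q ^ (k + 1)) q := by
    rw [qPochInf_eq_qPoch_mul _ hq k]
    congr 2
    ring
  rw [e] at n ⊢
  have n₁ := left_ne_zero_of_mul n
  have n₂ := right_ne_zero_of_mul n
  rw [quadTerm, quadPoly_eq_pow_mul_qPoch hD, quadCoeff, mul_pow]
  rw [← mul_div_mul_right _ _ n₂]
  simp only [div_eq_mul_inv, mul_inv]
  ring

/-! ### `q`-gamma functions and the three-parameter identity. -/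

theorem norm_ofReal_lt_one {q : ℝ} (h0 : 0 < q) (h1 : q < 1) : ‖(q : ℂ)‖ < 1 := by
  rwa [Complex.norm_real, Real.norm_of_nonneg h0.le]

theorem ofReal_sq_cpow {q : ℝ} (h0 : 0 < q) (x : ℂ) : ((q : ℂ) ^ 2) ^ x = (q : ℂ) ^ (2 * x) := by
  rw [sq, Complex.mul_cpow_ofReal_nonneg h0.le h0.le, two_mul,
    Complex.cpow_add _ _ (Complex.ofReal_ne_zero.2 h0.ne')]

theorem qGamma_sq_eq {q : ℝ} (h0 : 0 < q) (h1 : q < 1) (x : ℂ) :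
    qGamma (q ^ 2) x = qPochInf ((q : ℂ) ^ 2) ((q : ℂ) ^ 2)
      / qPochInf ((q : ℂ) ^ (2 * x)) ((q : ℂ) ^ 2)
        * ((1 - q : ℂ) ^ (1 - x) * (1 + q : ℂ) ^ (1 - x)) := by
  have e : (1 - (q : ℂ) ^ 2) = ((1 - q : ℝ) : ℂ) * ((1 + q : ℝ) : ℂ) := by
    push_cast
    ring
  rw [qGamma, Complex.ofReal_pow, ofReal_sq_cpow h0, e,
    Complex.mul_cpow_ofReal_nonneg (by linarith) (by linarith)]
  push_cast
  rfl

theorem qPochInf_eq_sq_mul {q : ℂ} (hq : ‖q‖ < 1) :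
    qPochInf q q = qPochInf q (q ^ 2) * qPochInf (q ^ 2) (q ^ 2) := by
  rw [qPochInf_eq_mul_sq q hq, ← sq]

/-- The `u`'s and `v`'s stand for powers of `1 - q` and `1 + q`, `H` and `P` for `(q; q²)_∞` and
`(q²; q²)_∞`, and the rest for the other products. The `xᵢ` and `yᵢ` may vanish, since they are only
inverted, never cancelled; `y` is cancelled and must be nonzero. -/
theorem gamma_quotient_cancel {K : Type*} [Field K]
    {u u₁ u₂ u₃ u₄ u₅ u₆ u₇ u₈ v₀ v₁ v₂ v₄ v₅ v₇ H P y x₀ x₁ x₂ y₀ y₁ y₂ : K}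
    (hHP : H * P ≠ 0) (hy : y ≠ 0)
    (hU : u * (u₁ * u₂ * u₃ * u₄) / (u₅ * u₆ * u₇ * u₈)
      * (v₀ * (v₁ * v₂ * v₄) / (v₅ * v₇)) = 1) :
    u * v₀ * (P / y * (u₁ * v₁)) * (P / y₀ * (u₂ * v₂)) * (H * P / y₂ * u₃)
        * (P / y₁ * (u₄ * v₄))
      / (P / H * (u₅ * v₅) * (H * P / (x₁ * y) * u₆) * (P / x₂ * (u₇ * v₇)) * (H * P / x₀ * u₈))
      = x₀ * (x₁ * x₂) / (y₀ * y₁ * y₂) := by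
  have hP := div_self (right_ne_zero_of_mul hHP)
  have hS := div_self hHP
  have hy' := div_self hy
  trans (u * (u₁ * u₂ * u₃ * u₄) / (u₅ * u₆ * u₇ * u₈)
      * (v₀ * (v₁ * v₂ * v₄) / (v₅ * v₇)))
    * ((H * P) / (H * P)) * ((H * P) / (H * P)) * (P / P) * (P / P) * (y / y)
    * (x₀ * (x₁ * x₂) / (y₀ * y₁ * y₂))
  · simp only [div_eq_mul_inv, mul_inv, inv_inv]
    ring
  · rw [hU, hS, hP, hy']
    ring

/-- The product side of the three-parameter identity in terms of `q`-gamma functions. -/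
theorem qGamma_quotient_eq {q : ℝ} (h0 : 0 < q) (h1 : q < 1) {b c d : ℂ}
    (hb : ∀ m : ℕ, (q : ℂ) ^ (2 - 2 * b + 2 * m) ≠ 1) :
    (1 - q : ℂ) * (1 + q : ℂ) ^ (2 * d + 1)
        * qGamma (q ^ 2) (1 - b) * qGamma (q ^ 2) (d + 1)
        * qGamma q (-2 * b + c + 1 / 2) * qGamma (q ^ 2) (c + d + 1)
      / (qGamma (q ^ 2) (1 / 2) * qGamma q (1 - 2 * b)
        * qGamma (q ^ 2) (-b + c + 1 / 2) * qGamma q (c + 2 * d + 1 / 2))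
      = qPochInf ((q : ℂ) ^ (c + 2 * d + 1 / 2)) q
        * (qPochInf ((q : ℂ) ^ (1 - 2 * b)) ((q : ℂ) ^ 2)
          * qPochInf ((q : ℂ) ^ (2 * c - 2 * b + 1)) ((q : ℂ) ^ 2))
        / (qPochInf ((q : ℂ) ^ (2 * d + 2)) ((q : ℂ) ^ 2)
          * qPochInf ((q : ℂ) ^ (2 * c + 2 * d + 2)) ((q : ℂ) ^ 2)
          * qPochInf ((q : ℂ) ^ (-2 * b + c + 1 / 2)) q) := by
  have hq := norm_ofReal_lt_one h0 h1
  have hq2 := norm_sq_lt_one hq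
  have hq0 : (q : ℂ) ≠ 0 := Complex.ofReal_ne_zero.2 h0.ne'
  have hu : (1 - q : ℂ) ≠ 0 := by exact_mod_cast (sub_pos.2 h1).ne'
  have hv : (1 + q : ℂ) ≠ 0 := by exact_mod_cast (by linarith : (0 : ℝ) < 1 + q).ne'
  have hy : qPochInf ((q : ℂ) ^ (2 * (1 - b))) ((q : ℂ) ^ 2) ≠ 0 := by
    refine qPochInf_ne_zero hq2 fun m => ?_
    convert hb m using 1
    rw [← pow_mul, ← Complex.cpow_natCast, ← Complex.cpow_add _ _ hq0]
    congr 1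
    push_cast
    ring
  have hP : qPochInf (q : ℂ) q ≠ 0 := qPochInf_ne_zero hq (mul_pow_ne_one hq hq)
  -- The second half of this splitting cancels against `Γ_{q²}(1 - b)`; this is where `hb` matters.
  have hx : qPochInf ((q : ℂ) ^ (1 - 2 * b)) q
      = qPochInf ((q : ℂ) ^ (1 - 2 * b)) ((q : ℂ) ^ 2)
        * qPochInf ((q : ℂ) ^ (2 * (1 - b))) ((q : ℂ) ^ 2) := by
    rw [qPochInf_eq_mul_sq _ hq]
    congr 2
    nth_rw 2 [← Complex.cpow_one (q : ℂ)]
    rw [← Complex.cpow_add _ _ hq0]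
    congr 1
    ring
  -- The total exponents of `1 - q` and of `1 + q` are both zero.
  have hU : (1 - q : ℂ) * ((1 - q : ℂ) ^ (1 - (1 - b)) * (1 - q : ℂ) ^ (1 - (d + 1))
        * (1 - q : ℂ) ^ (1 - (-2 * b + c + 1 / 2)) * (1 - q : ℂ) ^ (1 - (c + d + 1)))
      / ((1 - q : ℂ) ^ (1 - 1 / 2 : ℂ) * (1 - q : ℂ) ^ (1 - (1 - 2 * b))
        * (1 - q : ℂ) ^ (1 - (-b + c + 1 / 2)) * (1 - q : ℂ) ^ (1 - (c + 2 * d + 1 / 2)))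
      * ((1 + q : ℂ) ^ (2 * d + 1) * ((1 + q : ℂ) ^ (1 - (1 - b)) * (1 + q : ℂ) ^ (1 - (d + 1))
        * (1 + q : ℂ) ^ (1 - (c + d + 1)))
      / ((1 + q : ℂ) ^ (1 - 1 / 2 : ℂ) * (1 + q : ℂ) ^ (1 - (-b + c + 1 / 2)))) = 1 := by
    nth_rw 1 [← Complex.cpow_one (1 - q : ℂ)]
    simp only [← Complex.cpow_add _ _ hu, ← Complex.cpow_add _ _ hv, ← Complex.cpow_sub _ _ hu,
      ← Complex.cpow_sub _ _ hv]
    ring_nf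
    simp
  simp only [qGamma_sq_eq h0 h1]
  simp only [qGamma]
  rw [show (2 : ℂ) * (1 / 2) = 1 by norm_num, Complex.cpow_one,
    show 2 * (d + 1) = 2 * d + 2 by ring, show 2 * (c + d + 1) = 2 * c + 2 * d + 2 by ring,
    show 2 * (-b + c + 1 / 2) = 2 * c - 2 * b + 1 by ring, hx]
  rw [qPochInf_eq_sq_mul hq] at hP ⊢
  exact gamma_quotient_cancel hP hy hU

/-- `hasSum_quadratic` at `a = q^(c+2d+1/2)`, `B = q^(1/2-c)`, `B' = q^(c+1/2)`, `z =
q^(-(2b+2d+1))`. -/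
theorem hasSum_three_parameter {q : ℝ} (h0 : 0 < q) (h1 : q < 1) {b c d : ℂ}
    (hd : ∀ m : ℕ, (q : ℂ) ^ (2 * d + 2 + 2 * m) ≠ 1)
    (hcd : ∀ m : ℕ, (q : ℂ) ^ (2 * c + 2 * d + 2 + 2 * m) ≠ 1)
    (hbc : ∀ m : ℕ, (q : ℂ) ^ (-2 * b + c + 1 / 2 + m) ≠ 1) :
    HasSum
      (fun n : ℕ =>
        (q : ℂ) ^ (-2 * b * n + c * n + (n : ℂ) ^ 2 / 2)
          * (1 - (q : ℂ) ^ (c + 2 * d + 3 * n + 1 / 2))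
          * (qPoch ((q : ℂ) ^ (1 / 2 - c)) q n
            * qPoch ((q : ℂ) ^ (c + 1 / 2)) q n
            * qPoch ((q : ℂ) ^ (c + 2 * d + 1 / 2)) q n)
          * qPoch ((q : ℂ) ^ (2 * b + 2 * d + 1)) ((q : ℂ) ^ 2) n
        / (qPoch ((q : ℂ) ^ 2) ((q : ℂ) ^ 2) n
            * qPoch ((q : ℂ) ^ (2 * d + 2)) ((q : ℂ) ^ 2) n
            * qPoch ((q : ℂ) ^ (2 * c + 2 * d + 2)) ((q : ℂ) ^ 2) n
          * qPoch ((q : ℂ) ^ (-2 * b + c + 1 / 2)) q n))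
      (qPochInf ((q : ℂ) ^ (c + 2 * d + 1 / 2)) q
        * (qPochInf ((q : ℂ) ^ (1 - 2 * b)) ((q : ℂ) ^ 2)
          * qPochInf ((q : ℂ) ^ (2 * c - 2 * b + 1)) ((q : ℂ) ^ 2))
        / (qPochInf ((q : ℂ) ^ (2 * d + 2)) ((q : ℂ) ^ 2)
          * qPochInf ((q : ℂ) ^ (2 * c + 2 * d + 2)) ((q : ℂ) ^ 2)
          * qPochInf ((q : ℂ) ^ (-2 * b + c + 1 / 2)) q)) := by
  have hq := norm_ofReal_lt_one h0 h1
  have hq0 : (q : ℂ) ≠ 0 := Complex.ofReal_ne_zero.2 h0.ne'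
  have add : ∀ x y : ℂ, (q : ℂ) ^ x * (q : ℂ) ^ y = (q : ℂ) ^ (x + y) :=
    fun x y => (Complex.cpow_add x y hq0).symm
  have add_one : ∀ x : ℂ, (q : ℂ) ^ x * q = (q : ℂ) ^ (x + 1) := fun x => by
    rw [← add, Complex.cpow_one]
  have e₁ : (q : ℂ) ^ (c + 2 * d + 1 / 2) * q * (q : ℂ) ^ (1 / 2 - c) = (q : ℂ) ^ (2 * d + 2) := by
    rw [add_one, add]
    ring_nf
  have e₂ : (q : ℂ) ^ (c + 2 * d + 1 / 2) * q * (q : ℂ) ^ (c + 1 / 2)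
      = (q : ℂ) ^ (2 * c + 2 * d + 2) := by
    rw [add_one, add]
    ring_nf
  have e₃ : (q : ℂ) ^ (c + 2 * d + 1 / 2) * q * (q : ℂ) ^ (-(2 * b + 2 * d + 1))
      = (q : ℂ) ^ (-2 * b + c + 1 / 2) := by
    rw [add_one, add]
    ring_nf
  have hB : (q : ℂ) ^ (1 / 2 - c) * (q : ℂ) ^ (c + 1 / 2) = q := by
    rw [add, show 1 / 2 - c + (c + 1 / 2) = 1 by ring, Complex.cpow_one]
  have hD : (q : ℂ) ^ (-(2 * b + 2 * d + 1)) * (q : ℂ) ^ (2 * b + 2 * d + 1) = 1 := by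
    rw [add, neg_add_cancel, Complex.cpow_zero]
  have nat2 : ∀ (x : ℂ) (m : ℕ), (q : ℂ) ^ x * ((q : ℂ) ^ 2) ^ m = (q : ℂ) ^ (x + 2 * m) := by
    intro x m
    rw [← pow_mul, ← Complex.cpow_natCast, add]
    push_cast
    rfl
  have h := hasSum_quadratic hq hB hD
    (fun m => by rw [e₁, nat2]; exact hd m) (fun m => by rw [e₂, nat2]; exact hcd m)
    (fun m => by rw [e₃, ← Complex.cpow_natCast, add]; exact hbc m)
  rw [e₁, e₂, e₃, add, add, add, show 2 * d + 2 + -(2 * b + 2 * d + 1) = 1 - 2 * b by ring,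
    show 2 * c + 2 * d + 2 + -(2 * b + 2 * d + 1) = 2 * c - 2 * b + 1 by ring] at h
  refine h.congr_fun fun n => ?_
  have hp : ((q : ℂ) ^ (c + 2 * d + 1 / 2 + -(2 * b + 2 * d + 1))) ^ n
      * (q : ℂ) ^ (n + 1).choose 2 = (q : ℂ) ^ (-2 * b * n + c * n + (n : ℂ) ^ 2 / 2) := by
    rw [← Complex.cpow_nat_mul, ← Complex.cpow_natCast, add, Nat.cast_choose_two]
    push_cast
    ring_nf
  have hs : (q : ℂ) ^ (c + 2 * d + 3 * n + 1 / 2)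
      = (q : ℂ) ^ (c + 2 * d + 1 / 2) * (q : ℂ) ^ (3 * n) := by
    rw [← Complex.cpow_natCast, add]
    push_cast
    ring_nf
  rw [hs, ← hp, mul_comm (qPoch _ _ n * qPoch _ _ n) (qPoch ((q : ℂ) ^ (c + 2 * d + 1 / 2)) q n),
    ← mul_assoc (qPoch ((q : ℂ) ^ (c + 2 * d + 1 / 2)) q n)]

/-! ### The special series in base `q²`. -/

theorem qGamma_sq_half_sq {p : ℝ} (h0 : 0 < p) :
    qGamma (p ^ 2) (1 / 2) ^ 2
      = (1 - (p : ℂ) ^ 2) * (qPochInf ((p : ℂ) ^ 2) ((p : ℂ) ^ 2) / qPochInf p ((p : ℂ) ^ 2)) ^ 2 := by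
  have h : ((1 - (p : ℂ) ^ 2) ^ (1 - 1 / 2 : ℂ)) ^ 2 = 1 - (p : ℂ) ^ 2 := by
    rw [← Complex.cpow_nat_mul]
    norm_num
  rw [qGamma, Complex.ofReal_pow, ofReal_sq_cpow h0, show (2 : ℂ) * (1 / 2) = 1 by norm_num,
    Complex.cpow_one, mul_pow, h, mul_comm]

theorem hasSum_special {q : ℝ} (h0 : 0 < q) (h1 : q < 1) :
    HasSum
      (fun n : ℕ =>
        (q : ℂ) ^ (n ^ 2) * (1 - (q : ℂ) ^ (1 + 6 * n))
          * qPoch q ((q : ℂ) ^ 2) n ^ 2 * qPoch ((q : ℂ) ^ 2) ((q : ℂ) ^ 4) n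
        / qPoch ((q : ℂ) ^ 4) ((q : ℂ) ^ 4) n ^ 3)
      ((1 - (q : ℂ) ^ 4) / qGamma (q ^ 4) (1 / 2) ^ 2) := by
  have hq := norm_ofReal_lt_one h0 h1
  have hq0 : (q : ℂ) ≠ 0 := Complex.ofReal_ne_zero.2 h0.ne'
  have hq2 := norm_sq_lt_one hq
  have hq4 := norm_sq_lt_one hq2
  have e4 : (q : ℂ) * q ^ 2 * q = (q ^ 2) ^ 2 := by ring
  have e1 : (q : ℂ) * q ^ 2 * ((q : ℂ) ^ 2)⁻¹ = q := by field_simp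
  have e2 : ((q : ℂ) ^ 2) ^ 2 * ((q : ℂ) ^ 2)⁻¹ = q ^ 2 := by field_simp
  have h := hasSum_quadratic (q := (q : ℂ) ^ 2) (a := q) (B := q) (B' := q)
    (z := ((q : ℂ) ^ 2)⁻¹) (D := (q : ℂ) ^ 2) hq2 (by ring)
    (inv_mul_cancel₀ (pow_ne_zero 2 hq0))
    (fun m => by rw [e4]; exact mul_pow_ne_one hq4 hq4 m)
    (fun m => by rw [e4]; exact mul_pow_ne_one hq4 hq4 m)
    (fun m => by rw [e1]; exact mul_pow_ne_one hq2 hq m)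
  rw [e4, e1, e2] at h
  have n₀ : qPochInf (q : ℂ) ((q : ℂ) ^ 2) ≠ 0 := qPochInf_ne_zero hq2 (mul_pow_ne_one hq2 hq)
  have hr : (1 - (q : ℂ) ^ 4) / qGamma (q ^ 4) (1 / 2) ^ 2
      = qPochInf q ((q : ℂ) ^ 2) * (qPochInf ((q : ℂ) ^ 2) (((q : ℂ) ^ 2) ^ 2)
        * qPochInf ((q : ℂ) ^ 2) (((q : ℂ) ^ 2) ^ 2))
        / (qPochInf (((q : ℂ) ^ 2) ^ 2) (((q : ℂ) ^ 2) ^ 2)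
          * qPochInf (((q : ℂ) ^ 2) ^ 2) (((q : ℂ) ^ 2) ^ 2) * qPochInf q ((q : ℂ) ^ 2)) := by
    have e := qGamma_sq_half_sq (p := q ^ 2) (by positivity)
    rw [show (q ^ 2) ^ 2 = q ^ 4 by ring] at e
    have n : 1 - ((q : ℂ) ^ 2) ^ 2 ≠ 0 := by
      have := mul_pow_ne_one hq4 hq4 0
      rw [pow_zero, mul_one] at this
      exact sub_ne_zero.2 this.symm
    rw [e, Complex.ofReal_pow, show (q : ℂ) ^ 4 = ((q : ℂ) ^ 2) ^ 2 by ring,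
      mul_comm (qPochInf (q : ℂ) _), mul_div_mul_right _ _ n₀, ← sq, ← sq, div_mul_eq_div_div,
      div_self n, one_div, ← inv_pow, inv_div, div_pow]
  rw [hr]
  refine h.congr_fun fun n => ?_
  -- Here `a z q²` equals `q`, so one of the three factors `(q; q²)_n` in the numerator cancels.
  have n₁ : qPoch (q : ℂ) ((q : ℂ) ^ 2) n ≠ 0 := qPoch_ne_zero (mul_pow_ne_one hq2 hq) n
  have hc : 2 * (n + 1).choose 2 = n ^ 2 + n := by
    clear n₁
    induction n with
    | zero => rfl
    | succ n ih =>
      rw [choose_two_succ, mul_add, ih]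
      ring
  have hp : ((q : ℂ) * ((q : ℂ) ^ 2)⁻¹) ^ n * ((q : ℂ) ^ 2) ^ (n + 1).choose 2
      = (q : ℂ) ^ (n ^ 2) := by
    rw [← pow_mul, hc, pow_add, show (q : ℂ) * ((q : ℂ) ^ 2)⁻¹ = (q : ℂ)⁻¹ by field_simp,
      inv_pow]
    have := pow_ne_zero n hq0
    field_simp
  rw [hp, show (q : ℂ) * ((q : ℂ) ^ 2) ^ (3 * n) = (q : ℂ) ^ (1 + 6 * n) by ring,
    show (q : ℂ) ^ 4 = ((q : ℂ) ^ 2) ^ 2 by ring, ← mul_div_mul_right _ _ n₁]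
  congr 1
  · ring
  · ring

/-! ### The limit of the summands as `q → 1⁻`. -/

/-- The `q`-integer `1 + x + ⋯ + x ^ (m - 1)`. -/
noncomputable def qInt {K : Type*} [Semiring K] (x : K) (m : ℕ) : K :=
  ∑ i ∈ Finset.range m, x ^ i

theorem one_sub_pow_eq {K : Type*} [CommRing K] (x : K) (m : ℕ) :
    1 - x ^ m = (1 - x) * qInt x m := (mul_neg_geom_sum x m).symm

theorem qInt_one {K : Type*} [Semiring K] (m : ℕ) : qInt (1 : K) m = m := by simp [qInt]

theorem continuous_qInt {K : Type*} [Semiring K] [TopologicalSpace K] [IsTopologicalSemiring K]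
    (m : ℕ) : Continuous fun x : K => qInt x m := by
  unfold qInt
  fun_prop

theorem qPoch_pow_eq_qInt (x : ℂ) (m l n : ℕ) :
    qPoch (x ^ m) (x ^ l) n = (1 - x) ^ n * ∏ j ∈ Finset.range n, qInt x (m + l * j) := by
  simp only [qPoch, ← pow_mul, ← pow_add, one_sub_pow_eq, Finset.prod_mul_distrib,
    Finset.prod_const, Finset.card_range]

theorem ascPochhammer_eval_eq_prod (x : ℂ) (n : ℕ) :
    (ascPochhammer ℂ n).eval x = ∏ j ∈ Finset.range n, (x + j) := by
  induction n with
  | zero => simp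
  | succ n ih => rw [ascPochhammer_succ_eval, ih, Finset.prod_range_succ]

theorem tendsto_ofReal_nhdsLT_one : Tendsto (fun q : ℝ => (q : ℂ)) (𝓝[<] 1) (𝓝 1) := by
  have := Complex.continuous_ofReal.tendsto 1
  rw [Complex.ofReal_one] at this
  exact this.mono_left nhdsWithin_le_nhds

theorem tendsto_special_summand (n : ℕ) :
    Tendsto
      (fun q : ℝ =>
        ((q : ℂ) ^ (n ^ 2) * (1 - (q : ℂ) ^ (1 + 6 * n))
          * qPoch q ((q : ℂ) ^ 2) n ^ 2 * qPoch ((q : ℂ) ^ 2) ((q : ℂ) ^ 4) n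
        / qPoch ((q : ℂ) ^ 4) ((q : ℂ) ^ 4) n ^ 3) / (1 - q : ℂ))
      (𝓝[<] 1)
      (𝓝 ((1 / 4 : ℂ) ^ n
        * ((ascPochhammer ℂ n).eval (1 / 2) ^ 3 / (ascPochhammer ℂ n).eval 1 ^ 3)
        * (6 * n + 1))) := by
  -- The summand divided by `1 - q`, after the `3n + 1` factors `1 - q` above and below have
  -- cancelled.
  let F : ℂ → ℂ := fun x => x ^ (n ^ 2) * qInt x (1 + 6 * n)
    * (∏ j ∈ Finset.range n, qInt x (1 + 2 * j)) ^ 2 * (∏ j ∈ Finset.range n, qInt x (2 + 4 * j))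
    / (∏ j ∈ Finset.range n, qInt x (4 + 4 * j)) ^ 3
  have hne : (∏ j ∈ Finset.range n, qInt (1 : ℂ) (4 + 4 * j)) ^ 3 ≠ 0 := by
    refine pow_ne_zero 3 (Finset.prod_ne_zero_iff.2 fun j _ => ?_)
    rw [qInt_one]
    exact Nat.cast_ne_zero.2 (by omega)
  have hF : ContinuousAt F 1 := by
    have hc : ∀ m, Continuous fun x : ℂ => qInt x m := continuous_qInt
    have hp : ∀ m l, Continuous fun x : ℂ => ∏ j ∈ Finset.range n, qInt x (m + l * j) :=
      fun m l => continuous_finsetProd _ fun j _ => hc _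
    exact ((((continuous_pow _).mul (hc _)).mul ((hp 1 2).pow 2)).mul (hp 2 4)).continuousAt.div
      ((hp 4 4).pow 3).continuousAt hne
  have hF1 : F 1 = (1 / 4 : ℂ) ^ n
      * ((ascPochhammer ℂ n).eval (1 / 2) ^ 3 / (ascPochhammer ℂ n).eval 1 ^ 3)
      * (6 * n + 1) := by
    simp only [F, qInt_one, ascPochhammer_eval_eq_prod, one_pow, one_mul]
    have e₁ : ∀ j : ℕ, ((1 + 2 * j : ℕ) : ℂ) = 2 * (1 / 2 + j) := fun j => by push_cast; ring
    have e₂ : ∀ j : ℕ, ((2 + 4 * j : ℕ) : ℂ) = 4 * (1 / 2 + j) := fun j => by push_cast; ring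
    have e₃ : ∀ j : ℕ, ((4 + 4 * j : ℕ) : ℂ) = 4 * (1 + j) := fun j => by push_cast; ring
    simp only [e₁, e₂, e₃, Finset.prod_mul_distrib, Finset.prod_const, Finset.card_range]
    -- The powers combine as `(2^n)² 4^n / (4^n)³`, the source of `(1/4)^n`.
    have h4 : (4 : ℂ) ^ n = 2 ^ n * 2 ^ n := by rw [← mul_pow]; norm_num
    have h2 : (2 : ℂ) ^ n ≠ 0 := pow_ne_zero n two_ne_zero
    rw [div_pow, one_pow, h4]
    push_cast
    generalize (2 : ℂ) ^ n = t at *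
    field_simp
    ring
  rw [← hF1]
  refine (hF.tendsto.comp tendsto_ofReal_nhdsLT_one).congr' ?_
  filter_upwards [self_mem_nhdsWithin] with q hq
  have hu : (1 - q : ℂ) ≠ 0 := by exact_mod_cast (sub_pos.2 (Set.mem_Iio.1 hq)).ne'
  have h1 := qPoch_pow_eq_qInt (q : ℂ) 1 2 n
  rw [pow_one] at h1
  rw [Function.comp_apply, h1, qPoch_pow_eq_qInt, qPoch_pow_eq_qInt, one_sub_pow_eq]
  simp only [F]
  have hun := pow_ne_zero n hu
  generalize (1 - q : ℂ) ^ n = t at *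
  generalize (1 - q : ℂ) = u at *
  generalize (∏ j ∈ Finset.range n, qInt (q : ℂ) (4 + 4 * j)) = X
  generalize (∏ j ∈ Finset.range n, qInt (q : ℂ) (2 + 4 * j)) = Y
  generalize (∏ j ∈ Finset.range n, qInt (q : ℂ) (1 + 2 * j)) = Z
  generalize qInt (q : ℂ) (1 + 6 * n) = W
  rw [mul_pow t X, div_div, ← mul_div_mul_right _ (X ^ 3) (mul_ne_zero (pow_ne_zero 3 hun) hu)]
  congr 1 <;> ring

/-! ### The `q`-Wallis product and the limit of the right-hand side. -/

/-- The mean of `p^i` and `p^(2j-i)` is at least `p^j`; the induction peels off the outermost pair.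
-/
theorem mul_pow_le_qInt {p : ℝ} (h0 : 0 ≤ p) (j : ℕ) :
    (2 * j + 1) * p ^ j ≤ qInt p (2 * j + 1) := by
  induction j with
  | zero => simp [qInt]
  | succ j ih =>
    have e : qInt p (2 * (j + 1) + 1) = 1 + p * qInt p (2 * j + 1) + p ^ (2 * j + 2) := by
      rw [qInt, Finset.sum_range_succ, show 2 * (j + 1) = 2 * j + 1 + 1 by ring,
        Finset.sum_range_succ', qInt, Finset.mul_sum]
      simp only [pow_succ']
      ring
    rw [e]
    have h1 := mul_le_mul_of_nonneg_left ih h0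
    have h2 := sq_nonneg (1 - p ^ (j + 1))
    push_cast
    rw [show p ^ (2 * j + 2) = (p ^ (j + 1)) ^ 2 by ring]
    rw [show p * ((2 * j + 1) * p ^ j) = (2 * j + 1) * p ^ (j + 1) by ring] at h1
    nlinarith

/-- The `j`-th factor of the `q`-analogue of Wallis' product, minus one. -/
noncomputable def wallisTerm (p : ℝ) (j : ℕ) : ℝ :=
  p ^ (2 * j + 1) / (qInt p (2 * j + 1) * qInt p (2 * (j + 1) + 1))

theorem qInt_pos {p : ℝ} (h0 : 0 ≤ p) (j : ℕ) : 0 < qInt p (j + 1) := by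
  rw [qInt, Finset.sum_range_succ']
  positivity

/-- The power `p^(2j+1)` cancels against the lower bounds for the two `q`-integers, so the majorant
is free of `p`, as dominated convergence requires. -/
theorem norm_wallisTerm_le {p : ℝ} (h0 : 0 < p) (j : ℕ) :
    ‖wallisTerm p j‖ ≤ 1 / ((j + 1 : ℕ) : ℝ) ^ 2 := by
  have e₁ := mul_pow_le_qInt h0.le j
  have e₂ := mul_pow_le_qInt h0.le (j + 1)
  have p₁ := qInt_pos h0.le (2 * j)
  have p₂ := qInt_pos h0.le (2 * (j + 1))
  rw [wallisTerm, Real.norm_of_nonneg (by positivity), div_le_div_iff₀ (by positivity)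
    (by positivity)]
  have h := mul_le_mul e₁ e₂ (by positivity) p₁.le
  refine le_trans ?_ (h.trans_eq (one_mul _).symm)
  rw [show (2 * (j : ℝ) + 1) * p ^ j * ((2 * ((j + 1 : ℕ) : ℝ) + 1) * p ^ (j + 1))
    = p ^ (2 * j + 1) * ((2 * j + 1) * (2 * ((j + 1 : ℕ) : ℝ) + 1)) by ring]
  refine mul_le_mul_of_nonneg_left ?_ (by positivity)
  push_cast
  nlinarith [(Nat.cast_nonneg j : (0 : ℝ) ≤ j)]

theorem summable_wallis_bound : Summable fun j : ℕ => 1 / ((j + 1 : ℕ) : ℝ) ^ 2 :=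
  (summable_nat_add_iff 1).2 (Real.summable_one_div_nat_pow.2 one_lt_two)

theorem tendsto_prod_wallisTerm {p : ℝ} (h0 : 0 < p) :
    Tendsto (fun n => ∏ j ∈ Finset.range n, (1 + wallisTerm p j)) atTop
      (𝓝 (∏' j, (1 + wallisTerm p j))) :=
  (multipliable_one_add_of_summable (summable_wallis_bound.of_nonneg_of_le
    (fun _ => norm_nonneg _) (norm_wallisTerm_le h0))).hasProd.tendsto_prod_nat

theorem tprod_wallisTerm_one : ∏' j, (1 + wallisTerm 1 j) = Real.pi / 2 := by
  refine tendsto_nhds_unique (tendsto_prod_wallisTerm one_pos) ?_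
  refine Real.tendsto_prod_pi_div_two.congr fun n => Finset.prod_congr rfl fun j _ => ?_
  simp only [wallisTerm, qInt_one, one_pow]
  push_cast
  have : (0 : ℝ) ≤ j := Nat.cast_nonneg j
  field_simp
  ring

theorem tendsto_tprod_wallisTerm :
    Tendsto (fun p : ℝ => ∏' j, (1 + wallisTerm p j)) (𝓝[<] 1) (𝓝 (Real.pi / 2)) := by
  rw [← tprod_wallisTerm_one]
  refine tendsto_tprod_one_add_of_dominated_convergence summable_wallis_bound (fun j => ?_) ?_
  · refine Tendsto.mono_left ?_ nhdsWithin_le_nhds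
    refine ContinuousAt.div (by fun_prop)
      ((continuous_qInt _).mul (continuous_qInt _)).continuousAt ?_
    exact (mul_pos (qInt_pos zero_le_one _) (qInt_pos zero_le_one _)).ne'
  · filter_upwards [mem_nhdsWithin_of_mem_nhds (Ioi_mem_nhds (zero_lt_one (α := ℝ)))] with p hp
    exact norm_wallisTerm_le hp

theorem prod_wallisTerm {p : ℝ} (h0 : 0 < p) (h1 : p < 1) (n : ℕ) :
    ((∏ j ∈ Finset.range n, (1 + wallisTerm p j) : ℝ) : ℂ)
      = (1 - p) * (qPoch ((p : ℂ) ^ 2) ((p : ℂ) ^ 2) n ^ 2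
        / (qPoch p ((p : ℂ) ^ 2) n * qPoch p ((p : ℂ) ^ 2) (n + 1))) := by
  have hp := norm_ofReal_lt_one h0 h1
  have hp2 := norm_sq_lt_one hp
  have hu : (1 - p : ℂ) ≠ 0 := by exact_mod_cast (sub_pos.2 h1).ne'
  induction n with
  | zero => simp [qPoch, hu]
  | succ n ih =>
    have hm : ∀ m, ((qInt p m : ℝ) : ℂ) = qInt (p : ℂ) m := fun m => by simp [qInt]
    have n₀ := qPoch_ne_zero (mul_pow_ne_one hp2 hp) n
    have n₁ : qInt (p : ℂ) (2 * n + 1) ≠ 0 := by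
      rw [← hm]
      exact_mod_cast (qInt_pos h0.le _).ne'
    have n₂ : qInt (p : ℂ) (2 * (n + 1) + 1) ≠ 0 := by
      rw [← hm]
      exact_mod_cast (qInt_pos h0.le _).ne'
    have e₁ : 1 - (p : ℂ) * (p ^ 2) ^ n = (1 - p) * qInt (p : ℂ) (2 * n + 1) := by
      rw [← one_sub_pow_eq]
      ring
    have e₂ : 1 - (p : ℂ) * (p ^ 2) ^ (n + 1) = (1 - p) * qInt (p : ℂ) (2 * (n + 1) + 1) := by
      rw [← one_sub_pow_eq]
      ring
    -- This rests on `(1 - p^(2n+2))² - (1 - p^(2n+1))(1 - p^(2n+3)) = p^(2n+1) (1 - p)²`.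
    have e₃ : (1 - (p : ℂ) ^ 2 * (p ^ 2) ^ n) ^ 2 = (1 - p) ^ 2 * (p ^ (2 * n + 1)
        + qInt (p : ℂ) (2 * n + 1) * qInt (p : ℂ) (2 * (n + 1) + 1)) := by
      have e₄ : (1 - p : ℂ) ^ 2 * (qInt (p : ℂ) (2 * n + 1) * qInt (p : ℂ) (2 * (n + 1) + 1))
          = (1 - (p : ℂ) * (p ^ 2) ^ n) * (1 - (p : ℂ) * (p ^ 2) ^ (n + 1)) := by
        rw [e₁, e₂]
        ring
      rw [mul_add, e₄]
      ring
    rw [Finset.prod_range_succ, Complex.ofReal_mul, ih, qPoch_succ _ _ (n + 1), qPoch_succ _ _ n,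
      qPoch_succ _ _ n, mul_pow, e₁, e₂, e₃, wallisTerm]
    push_cast
    rw [hm, hm]
    generalize qInt (p : ℂ) (2 * n + 1) = X at *
    generalize qInt (p : ℂ) (2 * (n + 1) + 1) = Y at *
    generalize qPoch (p : ℂ) ((p : ℂ) ^ 2) n = Z at *
    generalize (1 - p : ℂ) = u at *
    field_simp
    ring

theorem qGamma_sq_half_sq_eq_tprod {p : ℝ} (h0 : 0 < p) (h1 : p < 1) :
    qGamma (p ^ 2) (1 / 2) ^ 2 = (1 + p) * ((∏' j, (1 + wallisTerm p j) : ℝ) : ℂ) := by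
  have hp := norm_ofReal_lt_one h0 h1
  have hp2 := norm_sq_lt_one hp
  have n₀ : qPochInf (p : ℂ) ((p : ℂ) ^ 2) ≠ 0 := qPochInf_ne_zero hp2 (mul_pow_ne_one hp2 hp)
  have h := ((Complex.continuous_ofReal.tendsto _).comp (tendsto_prod_wallisTerm h0))
  have ht := tendsto_qPoch (p : ℂ) hp2
  have h' := (((tendsto_qPoch ((p : ℂ) ^ 2) hp2).pow 2).div
    (ht.mul ((tendsto_add_atTop_iff_nat 1).2 ht)) (mul_ne_zero n₀ n₀)).const_mul (1 - p : ℂ)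
  rw [tendsto_nhds_unique h (h'.congr fun n => (prod_wallisTerm h0 h1 n).symm),
    qGamma_sq_half_sq h0, div_pow]
  ring

theorem tendsto_special_value :
    Tendsto
      (fun q : ℝ => ((1 - (q : ℂ) ^ 4) / qGamma (q ^ 4) (1 / 2) ^ 2) / (1 - q : ℂ))
      (𝓝[<] 1) (𝓝 (4 / (Real.pi : ℂ))) := by
  have hsq : Tendsto (fun q : ℝ => q ^ 2) (𝓝[<] 1) (𝓝[<] 1) := by
    refine tendsto_nhdsWithin_iff.2 ⟨?_, ?_⟩
    · have : Continuous fun q : ℝ => q ^ 2 := by fun_prop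
      simpa using (this.tendsto 1).mono_left nhdsWithin_le_nhds
    · filter_upwards [self_mem_nhdsWithin,
        mem_nhdsWithin_of_mem_nhds (Ioi_mem_nhds (zero_lt_one (α := ℝ)))] with q hq hq0
      exact pow_lt_one₀ (le_of_lt hq0) (Set.mem_Iio.1 hq) two_ne_zero
  have hW := (Complex.continuous_ofReal.tendsto _).comp (tendsto_tprod_wallisTerm.comp hsq)
  have hpi : ((Real.pi / 2 : ℝ) : ℂ) ≠ 0 := by exact_mod_cast (half_pos Real.pi_pos).ne'
  have hn : Tendsto (fun q : ℝ => (1 + q : ℂ)) (𝓝[<] 1) (𝓝 (1 + 1)) :=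
    tendsto_ofReal_nhdsLT_one.const_add 1
  have h := hn.div hW hpi
  rw [show (1 + 1 : ℂ) / ((Real.pi / 2 : ℝ) : ℂ) = 4 / (Real.pi : ℂ) by
    push_cast
    rw [div_div_eq_mul_div]
    norm_num] at h
  refine h.congr' ?_
  filter_upwards [self_mem_nhdsWithin,
    mem_nhdsWithin_of_mem_nhds (Ioi_mem_nhds (zero_lt_one (α := ℝ)))] with q hq hq0
  have h0 : 0 < q := hq0
  have h1 : q < 1 := hq
  have e := qGamma_sq_half_sq_eq_tprod (p := q ^ 2) (by positivity)
    (pow_lt_one₀ h0.le h1 two_ne_zero)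
  rw [show (q ^ 2) ^ 2 = q ^ 4 by ring] at e
  have hu : (1 - q : ℂ) ≠ 0 := by exact_mod_cast (sub_pos.2 h1).ne'
  have hv : (1 + (q : ℂ) ^ 2) ≠ 0 := by
    exact_mod_cast (by positivity : (0 : ℝ) < 1 + q ^ 2).ne'
  -- The factor `1 + q²` of `1 - q^4` cancels the prefactor `1 + p`, leaving `1 + q` over the Wallis
  -- product.
  rw [e, div_div, Complex.ofReal_pow,
    show 1 - (q : ℂ) ^ 4 = (1 + q) * ((1 + (q : ℂ) ^ 2) * (1 - q)) by ring, mul_right_comm,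
    mul_comm _ (Complex.ofReal _), mul_div_mul_right _ _ (mul_ne_zero hv hu)]
  rfl

theorem mainTheorem1 :
    -- the three-parameter identity
    (∀ (q : ℝ), 0 < q → q < 1 → ∀ (b c d : ℂ),
      -- no denominator of the series vanishes
      (∀ m : ℕ, (q : ℂ) ^ (2 * d + 2 + 2 * m) ≠ 1) →
      (∀ m : ℕ, (q : ℂ) ^ (2 * c + 2 * d + 2 + 2 * m) ≠ 1) →
      (∀ m : ℕ, (q : ℂ) ^ (-2 * b + c + 1 / 2 + m) ≠ 1) →
      -- `1 - b` is not a pole of `Γ_{q²}`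
      (∀ m : ℕ, (q : ℂ) ^ (2 - 2 * b + 2 * m) ≠ 1) →
      HasSum
        (fun n : ℕ =>
          (q : ℂ) ^ (-2 * b * n + c * n + (n : ℂ) ^ 2 / 2)
            * (1 - (q : ℂ) ^ (c + 2 * d + 3 * n + 1 / 2))
            * (qPoch ((q : ℂ) ^ (1 / 2 - c)) q n
              * qPoch ((q : ℂ) ^ (c + 1 / 2)) q n
              * qPoch ((q : ℂ) ^ (c + 2 * d + 1 / 2)) q n)
            * qPoch ((q : ℂ) ^ (2 * b + 2 * d + 1)) ((q : ℂ) ^ 2) n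
          / (qPoch ((q : ℂ) ^ 2) ((q : ℂ) ^ 2) n
              * qPoch ((q : ℂ) ^ (2 * d + 2)) ((q : ℂ) ^ 2) n
              * qPoch ((q : ℂ) ^ (2 * c + 2 * d + 2)) ((q : ℂ) ^ 2) n
            * qPoch ((q : ℂ) ^ (-2 * b + c + 1 / 2)) q n))
        ((1 - q : ℂ) * (1 + q : ℂ) ^ (2 * d + 1)
            * qGamma (q ^ 2) (1 - b) * qGamma (q ^ 2) (d + 1)
            * qGamma q (-2 * b + c + 1 / 2) * qGamma (q ^ 2) (c + d + 1)
          / (qGamma (q ^ 2) (1 / 2) * qGamma q (1 - 2 * b)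
            * qGamma (q ^ 2) (-b + c + 1 / 2) * qGamma q (c + 2 * d + 1 / 2)))) ∧
    -- the case `b = c = d = 0`, with `q²` in place of `q`
    (∀ (q : ℝ), 0 < q → q < 1 →
      HasSum
        (fun n : ℕ =>
          (q : ℂ) ^ (n ^ 2) * (1 - (q : ℂ) ^ (1 + 6 * n))
            * qPoch q ((q : ℂ) ^ 2) n ^ 2 * qPoch ((q : ℂ) ^ 2) ((q : ℂ) ^ 4) n
          / qPoch ((q : ℂ) ^ 4) ((q : ℂ) ^ 4) n ^ 3)
        ((1 - (q : ℂ) ^ 4) / qGamma (q ^ 4) (1 / 2) ^ 2)) ∧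
    -- it is a `q`-analogue of `∑ (1/4)^n (1/2)_n^3 / (1)_n^3 (6n+1) = 4/π`: divided by `1 - q`,
    -- its summand and its right-hand side tend to those of the latter as `q → 1⁻`
    (∀ n : ℕ,
      Tendsto
        (fun q : ℝ =>
          ((q : ℂ) ^ (n ^ 2) * (1 - (q : ℂ) ^ (1 + 6 * n))
            * qPoch q ((q : ℂ) ^ 2) n ^ 2 * qPoch ((q : ℂ) ^ 2) ((q : ℂ) ^ 4) n
          / qPoch ((q : ℂ) ^ 4) ((q : ℂ) ^ 4) n ^ 3) / (1 - q : ℂ))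
        (𝓝[<] 1)
        (𝓝 ((1 / 4 : ℂ) ^ n
          * ((ascPochhammer ℂ n).eval (1 / 2) ^ 3 / (ascPochhammer ℂ n).eval 1 ^ 3)
          * (6 * n + 1)))) ∧
    Tendsto
      (fun q : ℝ => ((1 - (q : ℂ) ^ 4) / qGamma (q ^ 4) (1 / 2) ^ 2) / (1 - q : ℂ))
      (𝓝[<] 1) (𝓝 (4 / (Real.pi : ℂ))) := by
  refine ⟨fun q h0 h1 b c d hd hcd hbc hb => ?_, fun q h0 h1 => hasSum_special h0 h1,
    tendsto_special_summand, tendsto_special_value⟩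
  rw [qGamma_quotient_eq h0 h1 hb]
  exact hasSum_three_parameter h0 h1 hd hcd hbc
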